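/- Conventions. We work in continuous first-order logic. A continuous signature $\mathcal L$ has function symbols (constant symbols are those of arity $0$) and predicate symbols, each equipped with an arity and a modulus of uniform continuity $\Delta:(0,1]\to(0,1]$. An $\mathcal L$-structure $\mathcal M$ is a nonempty complete metric space $(M,d)$ of diameter at most $1$ together with functions $M^k\to M$ and predicates $M^k\to[0,1]$ interpreting the symbols and obeying their moduli ($M^k$ carries the maximum metric). Formulas are built from the atomic formulas $d(t,t')$ and $P(t_1,\ldots,t_k)$ ($t,t',t_i$ terms) by means of all continuous connectives $u:[0,1]^k\to[0,1]$, $k\ge 0$, and the quantifiers $\sup_x$, $\inf_x$; a sentence is a formula without free variables. A theory $T$ is a set of conditions $\sigma=0$, $\sigma$ a sentence; $\mathcal M\models T$ means that $\sigma^{\mathcal M}=0$ for all of them, and $T\models\sigma=0$ means that $\sigma^{\mathcal M}=0$ for all $\mathcal M\models T$. $T$ is complete if it has a model and every sentence has the same value in all models of $T$. $T$ has quantifier elimination if for every formula $\psi(x_1,\ldots,x_l)$, $l\ge 0$, and every $\delta>0$ there is a quantifier-free formula $\chi(x_1,\ldots,x_l)$ with $|\psi^{\mathcal M}(\vec a)-\chi^{\mathcal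 M}(\vec a)|\le\delta$ for all $\mathcal M\models T$ and $\vec a\in M^l$. $T$ admits a universal axiomatization if it has the same models as some set of conditions $\sup_{\vec x}\chi(\vec x)=0$ with $\chi$ quantifier-free. Finally $r\mathbin{\dot-}s=\max(r-s,0)$. Corollary. Suppose that $T$ is a complete $\mathcal L$-theory with quantifier elimination that admits a universal axiomatization. Let $\vec x=(x_1,\ldots,x_m)$ and $\vec y=(y_1,\ldots,y_n)$, where $m\ge 1$, or $n=0$, or $\mathcal L$ has a constant symbol. Then for any formula $\varphi(\vec x,\vec y)$ and any $\epsilon>0$ there are an integer $k\ge 1$, $\mathcal L$-terms $$t_{11}(\vec x),\ldots,t_{1n}(\vec x),\ \ldots,\ t_{k1}(\vec x),\ldots,t_{kn}(\vec x)$$ and a (strictly) increasing continuous function $\alpha:[0,1]\to[0,1]$ with $\alpha(0)=0$ such that $$T\models\ \sup_{\vec x}\Bigl(\bigl(\min_{1\le i\le k}\varphi(\vec x,t_{i1}(\vec x),\ldots,t_{in}(\vec x))\mathbin{\dot-}\epsilon\bigr)\mathbin{\dot-}\alpha\bigl(\inf_{\vec y}\varphi(\vec x,\vec y)\bigr)\Bigr)=0.$$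 -/

import Mathlib

/-! # Continuous first-order logic (bounded metric structures, truth values in `[0,1]`) -/

universe u v w

namespace ContLogic

/-- The interval `(0,1]`, in which moduli of uniform continuity take their arguments and values. -/
abbrev UnitIoc : Type := Set.Ioc (0 : ℝ) 1

/-- A (one-sorted) continuous signature: function symbols (constants are the function symbols of
arity `0`) and predicate symbols, each with its arity and a modulus of uniform continuity
`Δ : (0,1] → (0,1]`. The metric symbol `d` is a logical symbol; the diameter bound is `1` and
predicates take values in `[0,1]`. -/
structure Signature where
  Functions : ℕ → Type u
  Relations : ℕ → Type v
  funModulus : ∀ {n : ℕ}, Functions n → UnitIoc → UnitIoc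
  relModulus : ∀ {n : ℕ}, Relations n → UnitIoc → UnitIoc

/-- An `L`-structure: a nonempty complete metric space of diameter at most `1`, with
interpretations of the symbols that obey the moduli of the signature. Finite powers carry the
maximum metric, which is Mathlib's metric on `Fin n → carrier`. -/
structure MetricStructure (L : Signature.{u, v}) where
  carrier : Type w
  [metricSpace : MetricSpace carrier]
  [completeSpace : CompleteSpace carrier]
  [nonempty : Nonempty carrier]
  dist_le_one : ∀ a b : carrier, dist a b ≤ 1
  funMap : ∀ {n : ℕ}, L.Functions n → (Fin n → carrier) → carrier
  relMap : ∀ {n : ℕ}, L.Relations n → (Fin n → carrier) → unitInterval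
  funMap_modulus : ∀ {n : ℕ} (f : L.Functions n) (ε : UnitIoc) (a b : Fin n → carrier),
    dist a b < (L.funModulus f ε : ℝ) → dist (funMap f a) (funMap f b) ≤ (ε : ℝ)
  relMap_modulus : ∀ {n : ℕ} (R : L.Relations n) (ε : UnitIoc) (a b : Fin n → carrier),
    dist a b < (L.relModulus R ε : ℝ) → |(relMap R a : ℝ) - (relMap R b : ℝ)| ≤ (ε : ℝ)

attribute [instance] MetricStructure.metricSpace MetricStructure.completeSpace
  MetricStructure.nonempty

/-- Terms in the variables `x_0, …, x_{n-1}`. -/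
inductive Term (L : Signature.{u, v}) (n : ℕ) : Type u
  | var : Fin n → Term L n
  | app : ∀ {k : ℕ}, L.Functions k → (Fin k → Term L n) → Term L n

/-- Formulas with free variables among `x_0, …, x_{n-1}`. Connectives are all continuous functions
`[0,1]^k → [0,1]`. The quantifiers `sup` and `inf` bind the last variable. -/
inductive Formula (L : Signature.{u, v}) : ℕ → Type (max u v)
  | dist : ∀ {n : ℕ}, Term L n → Term L n → Formula L n
  | rel : ∀ {n k : ℕ}, L.Relations k → (Fin k → Term L n) → Formula L n
  | conn : ∀ {n k : ℕ}, C(Fin k → unitInterval, unitInterval) → (Fin k → Formula L n) →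
      Formula L n
  | sup : ∀ {n : ℕ}, Formula L (n + 1) → Formula L n
  | inf : ∀ {n : ℕ}, Formula L (n + 1) → Formula L n

/-- Sentences are formulas without free variables. -/
abbrev Sentence (L : Signature.{u, v}) : Type (max u v) := Formula L 0

section Semantics

variable {L : Signature.{u, v}} (M : MetricStructure.{u, v, w} L)

/-- The value of a term in `M` at an assignment of the variables. -/
def Term.realize {n : ℕ} (a : Fin n → M.carrier) : Term L n → M.carrier
  | .var i => a i
  | .app f ts => M.funMap f (fun i => (ts i).realize a)

/-- The value in `[0,1]` of a formula in `M` at an assignment of the free variables. -/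
noncomputable def Formula.realize : {n : ℕ} → Formula L n → (Fin n → M.carrier) → unitInterval
  | _, .dist s t, a => ⟨Dist.dist (s.realize M a) (t.realize M a), dist_nonneg, M.dist_le_one _ _⟩
  | _, .rel R ts, a => M.relMap R (fun i => (ts i).realize M a)
  | _, .conn u φs, a => u (fun i => (φs i).realize a)
  | _, .sup φ, a => ⨆ b : M.carrier, φ.realize (Fin.snoc a b)
  | _, .inf φ, a => ⨅ b : M.carrier, φ.realize (Fin.snoc a b)

/-- `M` satisfies the closed condition `σ = 0`. -/
def MetricStructure.Satisfies (σ : Sentence L) : Prop := σ.realize M Fin.elim0 = 0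

end Semantics

section Syntax_operations

variable {L : Signature.{u, v}}

/-- Simultaneous substitution of terms for variables in a term. -/
def Term.subst {m n : ℕ} (s : Fin m → Term L n) : Term L m → Term L n
  | .var i => s i
  | .app f ts => .app f (fun i => (ts i).subst s)

/-- A term in `n` variables, seen as a term in `n + 1` variables. -/
def Term.lift {n : ℕ} (t : Term L n) : Term L (n + 1) := t.subst (fun i => .var i.castSucc)

/-- A substitution, extended by the identity on one further variable. -/
def liftSubst {m n : ℕ} (s : Fin m → Term L n) : Fin (m + 1) → Term L (n + 1) :=
  Fin.snoc (fun i => (s i).lift) (.var (Fin.last n))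

/-- Simultaneous capture-avoiding substitution of terms for the free variables of a formula. -/
def Formula.subst : {m n : ℕ} → (Fin m → Term L n) → Formula L m → Formula L n
  | _, _, s, .dist t₁ t₂ => .dist (t₁.subst s) (t₂.subst s)
  | _, _, s, .rel R ts => .rel R (fun i => (ts i).subst s)
  | _, _, s, .conn u φs => .conn u (fun i => (φs i).subst s)
  | _, _, s, .sup φ => .sup (φ.subst (liftSubst s))
  | _, _, s, .inf φ => .inf (φ.subst (liftSubst s))

/-- For `φ(x, y)` with `x = (x_1, …, x_m)` and `y = (y_1, …, y_n)`, and terms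
`t_1(x), …, t_n(x)`, the formula `φ(x, t_1(x), …, t_n(x))`. -/
def Formula.plug {m n : ℕ} (φ : Formula L (m + n)) (t : Fin n → Term L m) : Formula L m :=
  φ.subst (Fin.append (fun i => .var i) t)

/-- `inf_{y_1} ⋯ inf_{y_n} φ(x, y_1, …, y_n)`. -/
def Formula.infs {m : ℕ} : (n : ℕ) → Formula L (m + n) → Formula L m
  | 0, φ => φ
  | n + 1, φ => Formula.infs n (.inf φ)

/-- `sup_{x_1} ⋯ sup_{x_m} φ(x_1, …, x_m)`. -/
def Formula.sups : (m : ℕ) → Formula L m → Sentence L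
  | 0, φ => φ
  | m + 1, φ => Formula.sups m (.sup φ)

/-- Truncated subtraction `r ∸ s = max (r - s) 0` of a real number `s ≥ 0` from `r ∈ [0,1]`. -/
noncomputable def truncSub (r : unitInterval) (s : ℝ) : unitInterval :=
  Set.projIcc (0 : ℝ) 1 zero_le_one ((r : ℝ) - s)

theorem continuous_truncSub {X : Type*} [TopologicalSpace X] {f : X → unitInterval} {g : X → ℝ}
    (hf : Continuous f) (hg : Continuous g) : Continuous fun x => truncSub (f x) (g x) :=
  continuous_projIcc.comp ((continuous_subtype_val.comp hf).sub hg)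

/-- The formula `α(φ)`, for a continuous `α : [0,1] → [0,1]`. -/
def Formula.comp {n : ℕ} (α : C(unitInterval, unitInterval)) (φ : Formula L n) : Formula L n :=
  .conn (k := 1) ⟨fun x => α (x 0), by fun_prop⟩ (fun _ => φ)

/-- The formula `φ ∸ r`, for a real number `r ≥ 0`. -/
noncomputable def Formula.subConst {n : ℕ} (φ : Formula L n) (r : ℝ) : Formula L n :=
  φ.comp ⟨fun x => truncSub x r, continuous_truncSub continuous_id continuous_const⟩

/-- The formula `φ ∸ ψ`. -/
noncomputable def Formula.sub {n : ℕ} (φ ψ : Formula L n) : Formula L n :=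
  .conn (k := 2) ⟨fun x => truncSub (x 0) (x 1),
    continuous_truncSub (by fun_prop) (by fun_prop)⟩ ![φ, ψ]

/-- The formula `min_{i < k} φ_i` (used for `k > 0`). -/
noncomputable def Formula.minOf {n k : ℕ} (φs : Fin k → Formula L n) : Formula L n :=
  .conn ⟨fun x => Finset.univ.inf x,
    Continuous.finset_inf_apply fun i _ => continuous_apply i⟩ φs

/-- Quantifier-free formulas. -/
inductive Formula.IsQF : {n : ℕ} → Formula L n → Prop
  | dist {n : ℕ} (s t : Term L n) : IsQF (.dist s t)
  | rel {n k : ℕ} (R : L.Relations k) (ts : Fin k → Term L n) : IsQF (.rel R ts)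
  | conn {n k : ℕ} (u : C(Fin k → unitInterval, unitInterval)) (φs : Fin k → Formula L n) :
      (∀ i, IsQF (φs i)) → IsQF (.conn u φs)

/-- Universal sentences: `sup_{x_1} ⋯ sup_{x_m} φ(x_1, …, x_m)` with `φ` quantifier-free. -/
def IsUniversal (σ : Sentence L) : Prop :=
  ∃ (m : ℕ) (φ : Formula L m), φ.IsQF ∧ σ = Formula.sups m φ

end Syntax_operations

/-- An `L`-theory is a set of closed conditions `σ = 0`, given by the set of the sentences `σ`. -/
abbrev Theory (L : Signature.{u, v}) : Type (max u v) := Set (Sentence L)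

section Theories

variable {L : Signature.{u, v}}

/-- `M ⊨ T`. -/
def MetricStructure.Models (M : MetricStructure.{u, v, w} L) (T : Theory L) : Prop :=
  ∀ σ ∈ T, M.Satisfies σ

/-- `M` is a model of `T` with underlying set in a universe which is at least as large as that of
the symbols of `L`, so that the compactness and Löwenheim-Skolem theorems are available. -/
def IsModel (T : Theory L) (M : MetricStructure.{u, v, max u v w} L) : Prop := M.Models T

/-- `T ⊨ σ = 0`. -/
def Theory.Entails (T : Theory L) (σ : Sentence L) : Prop :=
  ∀ M : MetricStructure.{u, v, max u v w} L, IsModel.{u, v, w} T M → M.Satisfies σ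

/-- `T` is complete: it is satisfiable, and all its models give every sentence the same value
(that is, `T` axiomatizes the theory `{σ | σ^M = 0}` of a structure `M`). -/
def Theory.IsComplete (T : Theory L) : Prop :=
  (∃ M : MetricStructure.{u, v, max u v w} L, IsModel.{u, v, w} T M) ∧
    ∀ M N : MetricStructure.{u, v, max u v w} L, IsModel.{u, v, w} T M → IsModel.{u, v, w} T N →
      ∀ σ : Sentence L, σ.realize M Fin.elim0 = σ.realize N Fin.elim0

/-- `T` has quantifier elimination: every formula is, uniformly in all models of `T`,
approximable to any precision by quantifier-free formulas in the same variables. -/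
def Theory.HasQE (T : Theory L) : Prop :=
  ∀ (n : ℕ) (φ : Formula L n) (ε : ℝ), 0 < ε → ∃ ψ : Formula L n, ψ.IsQF ∧
    ∀ M : MetricStructure.{u, v, max u v w} L, IsModel.{u, v, w} T M → ∀ a : Fin n → M.carrier,
      |(φ.realize M a : ℝ) - (ψ.realize M a : ℝ)| ≤ ε

/-- `T` admits a universal axiomatization: there is a set of universal sentences which has the
same models as `T`. -/
def Theory.HasUniversalAxiomatization (T : Theory L) : Prop :=
  ∃ Γ : Theory L, (∀ σ ∈ Γ, IsUniversal σ) ∧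
    ∀ M : MetricStructure.{u, v, max u v w} L, IsModel.{u, v, w} T M ↔ IsModel.{u, v, w} Γ M

end Theories

end ContLogic

/-! A compactness argument. Suppose no finite set of term tuples and no `δ > 0` satisfy: whenever
`inf_y φ(a, y) < δ`, some tuple `t` in the set has `φ(a, t(a)) ≤ ε`. Collect counterexamples `(M i,
a i)` along an ultrafilter. The closed substructure of the ultraproduct generated by the class of
`a` consists of limits of terms in `a`. It is a model of `T`, because universal conditions pass to
substructures (`ultraHull.isModel`), and by quantifier elimination `inf_y φ` is small at `a` there.
A near-witness can be moved to a tuple of terms by density, and Łoś's theorem for quantifier-free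
formulas (`ultraHull.tendsto_realize`) carries it back to some `M i`, a contradiction.

This gives `exists_finset_terms`. Given `δ`, any increasing `α` that is at least `1 - ε` on `[δ, 1]`
completes the argument. -/

open Filter Topology UniformSpace

namespace ContLogic

/-! ### Substitution, quantifier blocks and continuity of realizations -/

section Realization

variable {L : Signature.{u, v}} (M : MetricStructure.{u, v, w} L)

theorem Term.realize_subst {m n : ℕ} (s : Fin m → Term L n) (t : Term L m)
    (a : Fin n → M.carrier) :
    (t.subst s).realize M a = t.realize M (fun i => (s i).realize M a) := by
  induction t with
  | var i => rfl
  | app f ts ih => simp only [Term.subst, Term.realize, ih]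

theorem Term.realize_lift {n : ℕ} (t : Term L n) (a : Fin n → M.carrier) (b : M.carrier) :
    t.lift.realize M (Fin.snoc a b) = t.realize M a := by
  simp [Term.lift, Term.realize_subst, Term.realize]

theorem realize_liftSubst {m n : ℕ} (s : Fin m → Term L n) (a : Fin n → M.carrier)
    (b : M.carrier) :
    (fun i => (liftSubst s i).realize M (Fin.snoc a b)) =
      (Fin.snoc (fun i => (s i).realize M a) b : Fin (m + 1) → M.carrier) := by
  funext i
  refine Fin.lastCases ?_ (fun j => ?_) i
  · simp [liftSubst, Term.realize]
  · simp [liftSubst, Term.realize_lift]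

theorem Formula.realize_subst {m : ℕ} (φ : Formula L m) :
    ∀ {n : ℕ} (s : Fin m → Term L n) (a : Fin n → M.carrier),
      (φ.subst s).realize M a = φ.realize M (fun i => (s i).realize M a) := by
  induction φ with
  | dist t₁ t₂ => intro n s a; simp only [Formula.subst, Formula.realize, Term.realize_subst]
  | rel R ts => intro n s a; simp only [Formula.subst, Formula.realize, Term.realize_subst]
  | conn u φs ih => intro n s a; simp only [Formula.subst, Formula.realize, ih]
  | sup φ ih => intro n s a; simp only [Formula.subst, Formula.realize, ih, realize_liftSubst]
  | inf φ ih => intro n s a; simp only [Formula.subst, Formula.realize, ih, realize_liftSubst]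

theorem Formula.realize_plug {m n : ℕ} (φ : Formula L (m + n)) (t : Fin n → Term L m)
    (a : Fin m → M.carrier) :
    (φ.plug t).realize M a = φ.realize M (Fin.append a (fun i => (t i).realize M a)) := by
  rw [Formula.plug, Formula.realize_subst]
  congr 1
  funext i
  refine Fin.addCases (fun j => ?_) (fun j => ?_) i <;> simp [Term.realize]

theorem Formula.realize_infs {m : ℕ} : ∀ (n : ℕ) (φ : Formula L (m + n)) (a : Fin m → M.carrier),
    (Formula.infs n φ).realize M a = ⨅ b : Fin n → M.carrier, φ.realize M (Fin.append a b)
  | 0, φ, a => by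
    have h (b : Fin 0 → M.carrier) : (Fin.append a b : Fin (m + 0) → M.carrier) = a := by
      rw [Subsingleton.elim b Fin.elim0]; exact Fin.append_elim0 a
    simp only [h, Formula.infs, ciInf_const]
  | n + 1, φ, a => by
    simp only [Formula.infs, Formula.realize_infs n, Formula.realize]
    have h (b : Fin n → M.carrier) (c : M.carrier) :
        (Fin.snoc (Fin.append a b) c : Fin (m + n + 1) → M.carrier) =
          Fin.append a (Fin.snoc b c : Fin (n + 1) → M.carrier) :=
      (Fin.append_snoc a b c).symm
    simp only [h]
    apply le_antisymm
    · refine le_iInf fun b => ?_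
      refine (iInf_le _ (Fin.init b)).trans ((iInf_le _ (b (Fin.last n))).trans ?_)
      rw [Fin.snoc_init_self]
    · exact le_iInf fun b => le_iInf fun c => iInf_le _ _

theorem satisfies_sups : ∀ (m : ℕ) (φ : Formula L m),
    M.Satisfies (Formula.sups m φ) ↔ ∀ a : Fin m → M.carrier, φ.realize M a = 0
  | 0, φ => by
    refine ⟨fun h a => ?_, fun h => h _⟩
    rw [Subsingleton.elim a Fin.elim0]; exact h
  | m + 1, φ => by
    rw [Formula.sups, satisfies_sups m]
    have hbot : (0 : unitInterval) = ⊥ := rfl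
    simp only [Formula.realize, hbot, iSup_eq_bot]
    refine ⟨fun h a => ?_, fun h a b => h _⟩
    rw [← Fin.snoc_init_self a]
    exact h _ _

theorem MetricStructure.continuous_funMap {n : ℕ} (f : L.Functions n) :
    Continuous (M.funMap f) := by
  rw [Metric.continuous_iff]
  intro b ε hε
  -- Moduli take arguments in `(0,1]` and give a non-strict bound, hence the cap at `1` and the
  -- halving.
  have hε' : 0 < min (ε / 2) 1 := by positivity
  refine ⟨L.funModulus f ⟨min (ε / 2) 1, hε', min_le_right _ _⟩, (L.funModulus f _).2.1, ?_⟩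
  intro a hab
  exact (M.funMap_modulus f _ _ _ hab).trans_lt
    ((min_le_left _ _).trans_lt (half_lt_self hε))

theorem MetricStructure.continuous_relMap {n : ℕ} (R : L.Relations n) :
    Continuous (M.relMap R) := by
  rw [Metric.continuous_iff]
  intro b ε hε
  have hε' : 0 < min (ε / 2) 1 := by positivity
  refine ⟨L.relModulus R ⟨min (ε / 2) 1, hε', min_le_right _ _⟩, (L.relModulus R _).2.1, ?_⟩
  intro a hab
  exact (M.relMap_modulus R _ _ _ hab).trans_lt
    ((min_le_left _ _).trans_lt (half_lt_self hε))

theorem Term.continuous_realize {n : ℕ} (t : Term L n) :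
    Continuous fun a : Fin n → M.carrier => t.realize M a := by
  induction t with
  | var i => exact continuous_apply i
  | app f ts ih => exact (M.continuous_funMap f).comp (continuous_pi ih)

/-- Pointwise continuity suffices for this induction; quantifiers would require uniform moduli. -/
theorem Formula.IsQF.continuous_realize {n : ℕ} {φ : Formula L n} (hφ : φ.IsQF) :
    Continuous fun a : Fin n → M.carrier => φ.realize M a := by
  induction hφ with
  | dist s t =>
    exact ((s.continuous_realize M).dist (t.continuous_realize M)).subtype_mk _
  | rel R ts =>
    exact (M.continuous_relMap R).comp (continuous_pi fun i => (ts i).continuous_realize M)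
  | conn u φs _ ih => exact u.continuous.comp (continuous_pi ih)

end Realization

/-- A map with a given modulus of uniform continuity extends to the completion with the same
modulus. -/
theorem exists_extension_modulus {k : ℕ} {X Y : Type*} [PseudoMetricSpace X] [MetricSpace Y]
    [CompleteSpace Y] (f : (Fin k → X) → Y) (Δ : UnitIoc → UnitIoc)
    (hf : ∀ ε a b, dist a b < (Δ ε : ℝ) → dist (f a) (f b) ≤ (ε : ℝ)) :
    ∃ g : (Fin k → Completion X) → Y, (∀ a : Fin k → X, g (fun i => (a i : Completion X)) = f a) ∧
      ∀ ε a b, dist a b < (Δ ε : ℝ) → dist (g a) (g b) ≤ (ε : ℝ) := by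
  set e : (Fin k → X) → (Fin k → Completion X) := Pi.map fun _ => ((↑) : X → Completion X)
  have hiso : Isometry e := Isometry.piMap _ fun _ => Completion.coe_isometry
  have hdense : DenseRange e := DenseRange.piMap fun _ => Completion.denseRange_coe
  have huc : UniformContinuous f := by
    rw [Metric.uniformContinuous_iff]
    intro ε hε
    have hε' : 0 < min (ε / 2) 1 := by positivity
    refine ⟨Δ ⟨min (ε / 2) 1, hε', min_le_right _ _⟩, (Δ _).2.1, ?_⟩
    intro a b hab
    exact (hf _ _ _ hab).trans_lt ((min_le_left _ _).trans_lt (half_lt_self hε))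
  have hdi : IsDenseInducing e := ⟨hiso.isUniformInducing.isInducing, hdense⟩
  have hcont : Continuous (hdi.extend f) :=
    (uniformContinuous_uniformly_extend hiso.isUniformInducing hdense huc).continuous
  have hext (a : Fin k → X) : hdi.extend f (e a) = f a := hdi.extend_eq huc.continuous a
  refine ⟨hdi.extend f, hext, fun ε a b hab => ?_⟩
  -- The strict hypothesis is an open condition and the non-strict conclusion a closed one, so the
  -- modulus need only be checked on a dense set of pairs.
  have hd2 : DenseRange (Prod.map e e) := hdense.prodMap hdense
  have hopen : IsOpen {p : (Fin k → Completion X) × (Fin k → Completion X) |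
      dist p.1 p.2 < (Δ ε : ℝ)} := isOpen_lt (by fun_prop) continuous_const
  have hclosed : IsClosed {p : (Fin k → Completion X) × (Fin k → Completion X) |
      dist (hdi.extend f p.1) (hdi.extend f p.2) ≤ (ε : ℝ)} :=
    isClosed_le (by fun_prop) continuous_const
  have hmem : (a, b) ∈ closure ({p : (Fin k → Completion X) × (Fin k → Completion X) |
      dist p.1 p.2 < (Δ ε : ℝ)} ∩ Set.range (Prod.map e e)) :=
    hd2.open_subset_closure_inter hopen hab
  refine closure_minimal ?_ hclosed hmem
  rintro _ ⟨h, ⟨⟨x, y⟩, rfl⟩⟩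
  simp only [Prod.map, Set.mem_ofPred_eq, hext, hiso.dist_eq] at h ⊢
  exact hf _ _ _ h

/-! ### Limits of truth values along an ultrafilter -/

section Ultralimit

variable {I : Type*} (U : Ultrafilter I)

/-- The limit of a family of truth values along an ultrafilter. -/
noncomputable def ulim (f : I → unitInterval) : unitInterval := (U.map f).lim

theorem tendsto_ulim (f : I → unitInterval) : Tendsto f U (𝓝 (ulim U f)) :=
  (U.map f).le_nhds_lim

theorem tendsto_coe_ulim (f : I → unitInterval) :
    Tendsto (fun i => (f i : ℝ)) U (𝓝 (ulim U f : ℝ)) :=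
  (continuous_subtype_val.tendsto _).comp (tendsto_ulim U f)

theorem ulim_eq {f : I → unitInterval} {r : unitInterval} (h : Tendsto f U (𝓝 r)) :
    ulim U f = r :=
  tendsto_nhds_unique (tendsto_ulim U f) h

end Ultralimit

/-! ### The closed hull of a tuple in an ultraproduct -/

section UltraHull

variable {L : Signature.{u, v}} {I : Type*} (U : Ultrafilter I)
  (M : I → MetricStructure.{u, v, max u v w} L) {m : ℕ} (a : ∀ i, Fin m → (M i).carrier)

/-- The terms in `m` variables, read as the elements of the ultraproduct of the `M i` that they
denote at the tuple given by the family `a`. -/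
structure TermPoint (U : Ultrafilter I) (M : I → MetricStructure.{u, v, max u v w} L) {m : ℕ}
    (a : ∀ i, Fin m → (M i).carrier) : Type (max u v w) where
  term : Term L m

/-- Distances are truth values, so their ultralimits exist by compactness of `[0,1]`. Distinct terms
may have distance `0`; `Completion` identifies them. -/
noncomputable instance : PseudoMetricSpace (TermPoint.{u, v, w} U M a) where
  dist s t := ulim U fun i => (Formula.dist s.term t.term).realize (M i) (a i)
  dist_self s := by
    refine congrArg Subtype.val (ulim_eq (r := 0) U ?_)
    refine tendsto_const_nhds.congr fun i => Subtype.ext ?_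
    exact (dist_self (s.term.realize (M i) (a i))).symm
  dist_comm s t := by
    refine congrArg (fun f => ((ulim U f : unitInterval) : ℝ)) (funext fun i => ?_)
    exact Subtype.ext (dist_comm _ _)
  dist_triangle s t r := by
    refine le_of_tendsto_of_tendsto' (tendsto_coe_ulim U _)
      ((tendsto_coe_ulim U _).add (tendsto_coe_ulim U _)) fun i => ?_
    exact dist_triangle _ _ _

theorem TermPoint.tendsto_dist (s t : TermPoint.{u, v, w} U M a) :
    Tendsto (fun i => dist (s.term.realize (M i) (a i)) (t.term.realize (M i) (a i))) U
      (𝓝 (dist s t)) :=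
  tendsto_coe_ulim U fun i => (Formula.dist s.term t.term).realize (M i) (a i)

theorem TermPoint.eventually_dist_lt {k : ℕ} {s t : Fin k → TermPoint.{u, v, w} U M a} {r : ℝ}
    (hr : 0 < r) (h : dist s t < r) :
    ∀ᶠ i in (U : Filter I), dist (fun j => (s j).term.realize (M i) (a i))
      (fun j => (t j).term.realize (M i) (a i)) < r := by
  simp only [dist_pi_lt_iff hr] at h ⊢
  exact eventually_all.2 fun j => (tendsto_dist U M a (s j) (t j)).eventually_lt_const (h j)

/-- The interpretation of a function symbol on terms. -/
def TermPoint.app {k : ℕ} (f : L.Functions k) (s : Fin k → TermPoint.{u, v, w} U M a) :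
    TermPoint.{u, v, w} U M a :=
  ⟨.app f fun j => (s j).term⟩

/-- A strict bound on a limit distance holds in `U`-almost every `M i`; the modulus applies there,
and its non-strict conclusion survives the limit. -/
theorem TermPoint.exists_funMap {k : ℕ} (f : L.Functions k) :
    ∃ g : (Fin k → Completion (TermPoint.{u, v, w} U M a)) →
        Completion (TermPoint.{u, v, w} U M a),
      (∀ s : Fin k → TermPoint.{u, v, w} U M a, g (fun j => (s j : Completion _)) = app U M a f s) ∧
      ∀ ε b c, dist b c < (L.funModulus f ε : ℝ) → dist (g b) (g c) ≤ (ε : ℝ) := by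
  refine exists_extension_modulus
    (fun s => (app U M a f s : Completion (TermPoint.{u, v, w} U M a))) _ fun ε s t hst => ?_
  rw [Completion.dist_eq]
  refine le_of_tendsto (tendsto_dist U M a _ _) ?_
  filter_upwards [eventually_dist_lt U M a (L.funModulus f ε).2.1 hst] with i hi
  exact (M i).funMap_modulus f ε _ _ hi

theorem TermPoint.exists_relMap {k : ℕ} (R : L.Relations k) :
    ∃ g : (Fin k → Completion (TermPoint.{u, v, w} U M a)) → unitInterval,
      (∀ s : Fin k → TermPoint.{u, v, w} U M a, g (fun j => (s j : Completion _)) =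
        ulim U fun i => (Formula.rel R fun j => (s j).term).realize (M i) (a i)) ∧
      ∀ ε b c, dist b c < (L.relModulus R ε : ℝ) → dist (g b) (g c) ≤ (ε : ℝ) := by
  refine exists_extension_modulus _ _ fun ε s t hst => ?_
  refine le_of_tendsto ((tendsto_ulim U _).dist (tendsto_ulim U _)) ?_
  filter_upwards [eventually_dist_lt U M a (L.relModulus R ε).2.1 hst] with i hi
  exact (M i).relMap_modulus R ε _ _ hi

variable [Nonempty (Term L m)]

/-- The closed substructure of the ultraproduct of the `M i` which is generated by the tuple given
by the family `a`. -/
noncomputable def ultraHull : MetricStructure.{u, v, max u v w} L where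
  carrier := Completion (TermPoint.{u, v, w} U M a)
  nonempty := ‹Nonempty (Term L m)›.map fun t => ((⟨t⟩ : TermPoint.{u, v, w} U M a) : Completion _)
  dist_le_one b c := by
    induction b, c using Completion.induction_on₂ with
    | hp => exact isClosed_le (by fun_prop) continuous_const
    | ih s t => rw [Completion.dist_eq]; exact (ulim U _).2.2
  funMap f := Classical.choose (TermPoint.exists_funMap U M a f)
  relMap R := Classical.choose (TermPoint.exists_relMap U M a R)
  funMap_modulus f := (Classical.choose_spec (TermPoint.exists_funMap U M a f)).2
  relMap_modulus R := (Classical.choose_spec (TermPoint.exists_relMap U M a R)).2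

/-- The element of `ultraHull U M a` denoted by a term. -/
noncomputable def ultraHull.mk (t : Term L m) : (ultraHull.{u, v, w} U M a).carrier :=
  ((TermPoint.mk t : TermPoint.{u, v, w} U M a) : Completion (TermPoint.{u, v, w} U M a))

theorem ultraHull.denseRange_mk (n : ℕ) :
    DenseRange fun (t : Fin n → Term L m) (j : Fin n) => ultraHull.mk U M a (t j) := by
  have h : DenseRange (ultraHull.mk U M a) := by
    refine (Completion.denseRange_coe (α := TermPoint.{u, v, w} U M a)).mono ?_
    rintro _ ⟨⟨t⟩, rfl⟩
    exact ⟨t, rfl⟩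
  exact DenseRange.piMap fun _ => h

theorem ultraHull.funMap_mk {k : ℕ} (f : L.Functions k) (t : Fin k → Term L m) :
    (ultraHull U M a).funMap f (fun j => mk U M a (t j)) = mk U M a (.app f t) :=
  (Classical.choose_spec (TermPoint.exists_funMap U M a f)).1 fun j => ⟨t j⟩

theorem ultraHull.relMap_mk {k : ℕ} (R : L.Relations k) (t : Fin k → Term L m) :
    (ultraHull U M a).relMap R (fun j => mk U M a (t j)) =
      ulim U fun i => (Formula.rel R t).realize (M i) (a i) :=
  (Classical.choose_spec (TermPoint.exists_relMap U M a R)).1 fun j => ⟨t j⟩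

theorem ultraHull.realize_term {n : ℕ} (s : Fin n → Term L m) (t : Term L n) :
    t.realize (ultraHull U M a) (fun j => mk U M a (s j)) = mk U M a (t.subst s) := by
  induction t with
  | var i => rfl
  | app f ts ih => simp only [Term.realize, ih, funMap_mk, Term.subst]

/-- Łoś's theorem for quantifier-free formulas and elements denoted by terms. -/
theorem ultraHull.tendsto_realize {n : ℕ} {φ : Formula L n} (hφ : φ.IsQF)
    (s : Fin n → Term L m) :
    Tendsto (fun i => φ.realize (M i) fun j => (s j).realize (M i) (a i)) U
      (𝓝 (φ.realize (ultraHull U M a) fun j => mk U M a (s j))) := by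
  induction hφ with
  | dist t₁ t₂ =>
    rw [tendsto_subtype_rng]
    simp only [Formula.realize, realize_term, ← Term.realize_subst]
    refine (TermPoint.tendsto_dist U M a ⟨t₁.subst s⟩ ⟨t₂.subst s⟩).trans_eq ?_
    rw [← Completion.dist_eq]
    rfl
  | rel R ts =>
    simp only [Formula.realize, realize_term, ← Term.realize_subst, relMap_mk]
    exact tendsto_ulim U _
  | conn u φs _ ih =>
    exact (u.continuous.tendsto _).comp (tendsto_pi_nhds.2 fun j => ih j)

/-- A universal condition holds at tuples of terms by Łoś, and at all tuples because it is closed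
and terms are dense. -/
theorem ultraHull.isModel {T : Theory L}
    (huniv : Theory.HasUniversalAxiomatization.{u, v, w} T)
    (hM : ∀ i, IsModel.{u, v, w} T (M i)) : IsModel.{u, v, w} T (ultraHull U M a) := by
  obtain ⟨Γ, hΓ, hT⟩ := huniv
  rw [hT]
  intro σ hσ
  obtain ⟨n, χ, hχ, rfl⟩ := hΓ σ hσ
  rw [satisfies_sups]
  refine isClosed_property (denseRange_mk U M a n)
    (isClosed_eq (hχ.continuous_realize _) continuous_const) fun s => ?_
  refine tendsto_nhds_unique (tendsto_realize U M a hχ s) ?_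
  have h (i : I) : χ.realize (M i) (fun j => (s j).realize (M i) (a i)) = 0 :=
    (satisfies_sups (M i) n χ).1 ((hT (M i)).1 (hM i) _ hσ) _
  simp only [h]
  exact tendsto_const_nhds

end UltraHull

/-! ### Finitely many term witnesses, and the function `α` -/

section Witnesses

variable {L : Signature.{u, v}}

/-- Realizations of the formula `φ(x, y)` at terms `t(x)` witness `inf_y φ(x, y)`, approximately and
uniformly in all models, for finitely many `t`. -/
theorem exists_finset_terms {T : Theory L} (hqe : Theory.HasQE.{u, v, w} T)
    (huniv : Theory.HasUniversalAxiomatization.{u, v, w} T) {m n : ℕ} [Nonempty (Term L m)]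
    (φ : Formula L (m + n)) {ε : ℝ} (hε : 0 < ε) :
    ∃ (F : Finset (Fin n → Term L m)) (δ : ℝ), 0 < δ ∧
      ∀ M : MetricStructure.{u, v, max u v w} L, IsModel.{u, v, w} T M → ∀ a : Fin m → M.carrier,
        ((Formula.infs n φ).realize M a : ℝ) < δ →
          ∃ t ∈ F, ((φ.plug t).realize M a : ℝ) ≤ ε := by
  classical
  by_contra! h
  -- Indexing by a finite set of tuples and an integer makes each tuple eventually excluded as a
  -- witness while the infimum tends to `0`.
  choose M hM a hinf hF using fun i : Finset (Fin n → Term L m) × ℕ =>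
    h i.1 (1 / ((i.2 : ℝ) + 1)) (by positivity)
  obtain ⟨U, hUle⟩ : ∃ U : Ultrafilter (Finset (Fin n → Term L m) × ℕ),
      (U : Filter (Finset (Fin n → Term L m) × ℕ)) ≤ atTop := Ultrafilter.exists_le _
  set N := ultraHull.{u, v, w} U M a
  have hNT : IsModel.{u, v, w} T N := ultraHull.isModel U M a huniv hM
  have hinfN : ((Formula.infs n φ).realize N (fun j => ultraHull.mk U M a (.var j)) : ℝ) <
      ε / 2 := by
    -- Łoś is available only for quantifier-free formulas, so one `ψ` serves in every `M i` and in
    -- `N`: the infimum in `N` is at most `ε/4 + ε/8 < ε/2`.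
    obtain ⟨ψ, hψ, hψT⟩ := hqe m (Formula.infs n φ) (ε / 8) (by positivity)
    have hlim := (continuous_subtype_val.tendsto _).comp
      (ultraHull.tendsto_realize U M a hψ Term.var)
    have hle : (ψ.realize N (fun j => ultraHull.mk U M a (.var j)) : ℝ) ≤ ε / 4 := by
      refine le_of_tendsto hlim ?_
      have hsmall : ∀ᶠ i : Finset (Fin n → Term L m) × ℕ in atTop,
          1 / ((i.2 : ℝ) + 1) < ε / 8 := by
        have h0 : Tendsto (fun i : Finset (Fin n → Term L m) × ℕ => 1 / ((i.2 : ℝ) + 1)) atTop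
            (𝓝 0) := by
          rw [← prod_atTop_atTop_eq]
          exact tendsto_one_div_add_atTop_nhds_zero_nat.comp tendsto_snd
        exact h0.eventually_lt_const (by positivity)
      filter_upwards [hUle hsmall] with i hi
      have h1 := abs_le.1 (hψT (M i) (hM i) (a i))
      have h2 := hinf i
      change (ψ.realize (M i) (a i) : ℝ) ≤ ε / 4
      linarith
    have := abs_le.1 (hψT N hNT fun j => ultraHull.mk U M a (.var j))
    linarith
  obtain ⟨b, hb⟩ : ∃ b : Fin n → N.carrier,
      (φ.realize N (Fin.append (fun j => ultraHull.mk U M a (.var j)) b) : ℝ) < ε / 2 := by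
    by_contra! hall
    have h1 : ε / 2 ≤ 1 :=
      (hall fun _ => Classical.arbitrary N.carrier).trans (unitInterval.le_one _)
    rw [Formula.realize_infs] at hinfN
    exact hinfN.not_ge (le_iInf (a := (⟨ε / 2, by positivity, h1⟩ : unitInterval)) hall)
  -- `φ` may itself contain quantifiers. Its approximation `χ` is below `5ε/8` at `b`, hence below
  -- `3ε/4` at a nearby tuple of terms; back in `M i` this gives `φ < 7ε/8`.
  obtain ⟨χ, hχ, hχT⟩ := hqe (m + n) φ (ε / 8) (by positivity)
  have hcont : Continuous fun b : Fin n → N.carrier =>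
      (χ.realize N (Fin.append (fun j => ultraHull.mk U M a (.var j)) b) : ℝ) := by
    refine continuous_subtype_val.comp ((hχ.continuous_realize N).comp (continuous_pi fun j => ?_))
    refine Fin.addCases (fun j => ?_) (fun j => ?_) j
    · simpa using continuous_const
    · simpa using continuous_apply j
  obtain ⟨t, ht⟩ := (ultraHull.denseRange_mk U M a n).exists_mem_open
    (isOpen_lt hcont (continuous_const (y := 3 * ε / 4))) ⟨b, by
      have := abs_le.1 (hχT N hNT (Fin.append (fun j => ultraHull.mk U M a (.var j)) b))
      rw [Set.mem_ofPred_eq]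
      linarith⟩
  have happ : (Fin.append (fun j => ultraHull.mk U M a (.var j))
      (fun j => ultraHull.mk U M a (t j)) : Fin (m + n) → N.carrier) =
      fun j => ultraHull.mk U M a (Fin.append Term.var t j) := by
    funext j
    refine Fin.addCases (fun j => ?_) (fun j => ?_) j <;> simp
  change (χ.realize N (Fin.append (fun j => ultraHull.mk U M a (.var j))
      (fun j => ultraHull.mk U M a (t j))) : ℝ) < 3 * ε / 4 at ht
  rw [happ] at ht
  have hlim := (continuous_subtype_val.tendsto _).comp
    (ultraHull.tendsto_realize U M a hχ (Fin.append Term.var t))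
  have hmem : ∀ᶠ i : Finset (Fin n → Term L m) × ℕ in atTop, t ∈ i.1 := by
    filter_upwards [eventually_ge_atTop (({t}, 0) : Finset (Fin n → Term L m) × ℕ)] with i hi
    exact Finset.singleton_subset_iff.1 hi.1
  obtain ⟨i, hi, hti⟩ := ((hlim.eventually_lt_const ht).and (hUle hmem)).exists
  have h1 := hF i t hti
  rw [Formula.plug, Formula.realize_subst] at h1
  have h2 := abs_le.1 (hχT (M i) (hM i)
    fun j => (Fin.append Term.var t j).realize (M i) (a i))
  change (χ.realize (M i) (fun j => (Fin.append Term.var t j).realize (M i) (a i)) : ℝ) < _ at hi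
  change ε < (φ.realize (M i) (fun j => (Fin.append Term.var t j).realize (M i) (a i)) : ℝ) at h1
  linarith

theorem coe_truncSub_le {r : unitInterval} {s c : ℝ} (hc : 0 ≤ c) (h : (r : ℝ) - s ≤ c) :
    (truncSub r s : ℝ) ≤ c := by
  rw [truncSub, Set.coe_projIcc]
  exact max_le hc ((min_le_right _ _).trans h)

theorem truncSub_eq_zero {r : unitInterval} {s : ℝ} (h : (r : ℝ) ≤ s) : truncSub r s = 0 :=
  Set.projIcc_of_le_left _ (by linarith)

/-- A strictly increasing self-map of `[0,1]` which fixes `0` and is at least `1 - ε` from `δ`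
on. -/
theorem exists_strictMono_ge {δ ε : ℝ} (hδ : 0 < δ) (hε : 0 < ε) :
    ∃ α : C(unitInterval, unitInterval), StrictMono α ∧ α 0 = 0 ∧
      ∀ s : unitInterval, δ ≤ s → 1 - ε ≤ α s := by
  set e := min ε 1
  have he0 : 0 < e := by positivity
  have he1 : e ≤ 1 := min_le_right _ _
  have heε : e ≤ ε := min_le_left _ _
  -- In this convex combination the term `e * s` gives strict monotonicity, and the truncated ramp
  -- gives the value at least `1 - e` from `δ` on.
  have h01 (s : unitInterval) :
      (1 - e) * min ((s : ℝ) / δ) 1 + e * s ∈ unitInterval := by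
    have hs0 := s.2.1
    have hs1 := s.2.2
    have h1 : 0 ≤ min ((s : ℝ) / δ) 1 := by positivity
    have h2 : min ((s : ℝ) / δ) 1 ≤ 1 := min_le_right _ _
    constructor <;> nlinarith
  refine ⟨⟨fun s => ⟨_, h01 s⟩, by fun_prop⟩, fun s t hst => ?_, ?_, fun s hs => ?_⟩
  · have hst' : (s : ℝ) < t := hst
    have h1 : min ((s : ℝ) / δ) 1 ≤ min ((t : ℝ) / δ) 1 := by gcongr
    change (1 - e) * min ((s : ℝ) / δ) 1 + e * s < (1 - e) * min ((t : ℝ) / δ) 1 + e * t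
    nlinarith
  · apply Subtype.ext
    simp
  · have h1 : min ((s : ℝ) / δ) 1 = 1 := min_eq_right ((one_le_div hδ).2 hs)
    have hs0 := s.2.1
    change 1 - ε ≤ (1 - e) * min ((s : ℝ) / δ) 1 + e * s
    rw [h1]
    nlinarith

theorem Term.nonempty_of {m : ℕ} (h : 0 < m ∨ Nonempty (L.Functions 0)) :
    Nonempty (Term L m) := by
  rcases h with h | ⟨⟨c⟩⟩
  · exact ⟨.var ⟨0, h⟩⟩
  · exact ⟨.app c Fin.elim0⟩

theorem entails_of_forall_exists_le {T : Theory L} {m n k : ℕ} {φ : Formula L (m + n)} {ε δ : ℝ}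
    {t : Fin k → Fin n → Term L m} {α : C(unitInterval, unitInterval)}
    (h : ∀ M : MetricStructure.{u, v, max u v w} L, IsModel.{u, v, w} T M →
      ∀ a : Fin m → M.carrier, ((Formula.infs n φ).realize M a : ℝ) < δ →
        ∃ i, ((φ.plug (t i)).realize M a : ℝ) ≤ ε)
    (hα : ∀ s : unitInterval, δ ≤ s → 1 - ε ≤ α s) :
    Theory.Entails.{u, v, w} T
      (Formula.sups m (((Formula.minOf fun i => φ.plug (t i)).subConst ε).sub
        ((Formula.infs n φ).comp α))) := by
  intro M hM
  rw [satisfies_sups]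
  intro a
  change truncSub (truncSub (Finset.univ.inf fun i => (φ.plug (t i)).realize M a) ε)
    (α ((Formula.infs n φ).realize M a)) = 0
  refine truncSub_eq_zero (coe_truncSub_le (unitInterval.nonneg _) ?_)
  -- Below `δ` the minimum is at most `ε`; from `δ` on, `α` absorbs whatever remains, since truth
  -- values are at most `1`.
  rcases lt_or_ge ((Formula.infs n φ).realize M a : ℝ) δ with hlt | hge
  · obtain ⟨i, hi⟩ := h M hM a hlt
    have h1 : ((Finset.univ.inf fun i => (φ.plug (t i)).realize M a : unitInterval) : ℝ) ≤
        (φ.plug (t i)).realize M a :=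
      Finset.inf_le (f := fun i => (φ.plug (t i)).realize M a) (Finset.mem_univ i)
    have h2 := unitInterval.nonneg (α ((Formula.infs n φ).realize M a))
    linarith
  · have h1 := unitInterval.le_one (Finset.univ.inf fun i => (φ.plug (t i)).realize M a)
    have h2 := hα _ hge
    linarith

end Witnesses

end ContLogic
theorem corollary2p7 {L : ContLogic.Signature.{u, v}} (T : ContLogic.Theory L)
    (hcomplete : ContLogic.Theory.IsComplete.{u, v, w} T)
    (hqe : ContLogic.Theory.HasQE.{u, v, w} T)
    (huniv : ContLogic.Theory.HasUniversalAxiomatization.{u, v, w} T)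
    (m n : ℕ) (hmn : 0 < m ∨ n = 0 ∨ Nonempty (L.Functions 0))
    (φ : ContLogic.Formula L (m + n)) (ε : ℝ) (hε : 0 < ε) :
    ∃ (k : ℕ) (_ : 0 < k) (t : Fin k → Fin n → ContLogic.Term L m)
      (α : C(unitInterval, unitInterval)), StrictMono α ∧ α 0 = 0 ∧
      ContLogic.Theory.Entails.{u, v, w} T
        (ContLogic.Formula.sups m
          (((ContLogic.Formula.minOf fun i => φ.plug (t i)).subConst ε).sub
            ((ContLogic.Formula.infs n φ).comp α))) := by
  classical
  open ContLogic in
  suffices h : ∃ (F : Finset (Fin n → Term L m)) (δ : ℝ), F.Nonempty ∧ 0 < δ ∧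
      ∀ M : MetricStructure.{u, v, max u v w} L, IsModel.{u, v, w} T M → ∀ a : Fin m → M.carrier,
        ((Formula.infs n φ).realize M a : ℝ) < δ →
          ∃ t ∈ F, ((φ.plug t).realize M a : ℝ) ≤ ε by
    obtain ⟨F, δ, hF, hδ, h⟩ := h
    obtain ⟨α, hmono, hα0, hα⟩ := exists_strictMono_ge hδ hε
    refine ⟨F.card, hF.card_pos, fun i => F.equivFin.symm i, α, hmono, hα0,
      entails_of_forall_exists_le (fun M hM a ha => ?_) hα⟩
    obtain ⟨t, ht, hle⟩ := h M hM a ha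
    exact ⟨F.equivFin ⟨t, ht⟩, by simpa using hle⟩
  -- For `n = 0` there may be no terms at all, hence no hull; the empty tuple is then a witness with
  -- `δ = ε`.
  by_cases hn : n = 0
  · subst hn
    refine ⟨{Fin.elim0}, ε, Finset.singleton_nonempty _, hε, fun M _ a ha =>
      ⟨_, Finset.mem_singleton_self _, ?_⟩⟩
    rw [ContLogic.Formula.realize_infs] at ha
    rw [ContLogic.Formula.realize_plug]
    refine le_trans ?_ ha.le
    exact le_iInf fun b => (congrArg (fun b => φ.realize M (Fin.append a b))
      (Subsingleton.elim _ b)).le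
  · have hne : Nonempty (ContLogic.Term L m) := ContLogic.Term.nonempty_of (by tauto)
    obtain ⟨F, δ, hδ, h⟩ := ContLogic.exists_finset_terms hqe huniv φ hε
    -- `F` may be empty if the infimum never drops below `δ`; an arbitrary extra tuple ensures `k >
    -- 0`.
    refine ⟨insert (fun _ => Classical.choice hne) F, δ, Finset.insert_nonempty _ _, hδ,
      fun M hM a ha => ?_⟩
    obtain ⟨t, ht, hle⟩ := h M hM a ha
    exact ⟨t, Finset.mem_insert_of_mem ht, hle⟩
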